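/- Let $m \ge 1$, let $\mathscr S'(\mathbb R^m)$ be the space of tempered distributions on $\mathbb R^m$ and $\mathscr S'_c(\mathbb R^m)$ the subspace of those with compact support. Let $\mathcal F:\mathscr S'(\mathbb R^m)\to\mathscr S'(\mathbb R^m)$ be the Fourier transform, normalized on Schwartz functions by $\mathcal F(\varphi)(\xi)=(2\pi)^{-m/2}\int_{\mathbb R^m} e^{-i x\cdot\xi}\varphi(x)\,dx$. Let $w:\mathbb R^m\to\mathbb C$ be of class $C^\infty$ with $w(x)\neq 0$ for all $x$, let $\alpha\in\mathbb C\setminus\mathbb R$, and let $\check p\in\mathscr S'_c(\mathbb R^m)\setminus\{0\}$. Define for $h\in \mathscr S'_c(\mathbb R^m)$ and $\xi\in\mathbb R^m$, with $\xi^2=\xi_1^2+\dots+\xi_m^2$, $$F(h)(\xi)=\bigl|\mathcal F(\check p)(\xi)\,e^{\alpha \xi^2}+\mathcal F(w\cdot h)(\xi)\bigr|^2,$$ $$F_{\mathrm{lin}}(h)(\xi)=\bigl|\mathcal F(\check p)(\xi)\,e^{\alpha \xi^2}+\mathcal F(w\cdot h)(\xi)\bigr|^2-\bigl|\mathcal F(w\cdot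 h)(\xi)\bigr|^2 .$$ Then $F$ and $F_{\mathrm{lin}}$ are well-defined maps $\mathscr S'_c(\mathbb R^m)\to C^\infty(\mathbb R^m)$: for every $h \in \mathscr S'_c(\mathbb R^m)$ there is exactly one $w\cdot h\in\mathscr S'_c(\mathbb R^m)$ with $(w\cdot h)(\varphi)=h(w\varphi)$ for all $\varphi\in C_c^\infty(\mathbb R^m)$; the Fourier transform of every $u\in\mathscr S'_c(\mathbb R^m)$ is given by a unique $C^\infty$ function; and $F(h)$, $F_{\mathrm{lin}}(h)$ are of class $C^\infty$. Moreover, $F$ and $F_{\mathrm{lin}}$ are injective. Finally, for every nonempty open set $U\subset\mathbb R^m$, every $h\in\mathscr S'_c(\mathbb R^m)$ is uniquely determined by $F(h)|_U$, and also by $F_{\mathrm{lin}}(h)|_U$; that is, both maps $h\mapsto F(h)|_U$ and $h\mapsto F_{\mathrm{lin}}(h)|_U$ are injective on $\mathscr S'_c(\mathbb R^m)$. -/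

import Mathlib

open Distribution SchwartzMap MeasureTheory
open scoped ContDiff FourierTransform

noncomputable section

namespace PhaseRetrieval

/-- The Euclidean space `ℝ^m`. -/
abbrev Euc (m : ℕ) : Type := EuclideanSpace ℝ (Fin m)

/-- Tempered distributions on `ℝ^m` with compact support. -/
abbrev CompactDist (m : ℕ) : Type :=
  {u : 𝓢'(Euc m, ℂ) // IsCompact (dsupport u)}

/-- The dilation `ξ ↦ (2π)⁻¹ ξ` of `ℝ^m`. -/
def dilation (m : ℕ) : Euc m ≃L[ℝ] Euc m :=
  ContinuousLinearEquiv.smulLeft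
    (Units.mk0 ((2 * Real.pi)⁻¹ : ℝ) (inv_ne_zero Real.two_pi_pos.ne'))

/-- The unitary Fourier transform on Schwartz functions,
`(𝓕 φ)(ξ) = (2π)^(-m/2) ∫ exp(-i x·ξ) φ(x) dx`, obtained by rescaling Mathlib's transform,
whose kernel is `exp(-2πi x·ξ)`. -/
def fourierSchwartz (m : ℕ) : 𝓢(Euc m, ℂ) →L[ℂ] 𝓢(Euc m, ℂ) :=
  (((2 * Real.pi) ^ (-(m : ℝ) / 2) : ℝ) : ℂ) •
    (SchwartzMap.compCLMOfContinuousLinearEquiv ℂ (dilation m)).comp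
      (FourierTransform.fourierCLM ℂ 𝓢(Euc m, ℂ))

theorem fourierSchwartz_apply (m : ℕ) (φ : 𝓢(Euc m, ℂ)) (ξ : Euc m) :
    fourierSchwartz m φ ξ = (((2 * Real.pi) ^ (-(m : ℝ) / 2) : ℝ) : ℂ) *
      ∫ x, Complex.exp (-Complex.I * (inner ℝ x ξ : ℝ)) * φ x := by
  have hd : dilation m ξ = ((2 * Real.pi)⁻¹ : ℝ) • ξ := rfl
  have h1 : fourierSchwartz m φ ξ = (((2 * Real.pi) ^ (-(m : ℝ) / 2) : ℝ) : ℂ) *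
      𝓕 (φ : Euc m → ℂ) (dilation m ξ) := rfl
  rw [h1, Real.fourier_eq', hd]
  congr 2
  funext x
  rw [smul_eq_mul, inner_smul_right]
  congr 2
  push_cast
  field_simp

/-- The unitary Fourier transform on tempered distributions, by duality. -/
def fourierDist (m : ℕ) : 𝓢'(Euc m, ℂ) →L[ℂ] 𝓢'(Euc m, ℂ) :=
  PointwiseConvergenceCLM.precomp ℂ (fourierSchwartz m)

/-- `v` is the product `w · u` of the distribution `u` with the function `w`:
`v(φ) = u(w φ)` for all compactly supported smooth functions `φ`. -/
def IsProduct {m : ℕ} (w : Euc m → ℂ) (u v : 𝓢'(Euc m, ℂ)) : Prop :=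
  ∀ φ ψ : 𝓢(Euc m, ℂ), HasCompactSupport φ → (∀ x, ψ x = w x * φ x) → v φ = u ψ

open Classical in
/-- The product `w · h`, again a compactly supported distribution. (The default value is never
used for smooth `w`.) -/
def smoothMul {m : ℕ} (w : Euc m → ℂ) (h : CompactDist m) : 𝓢'(Euc m, ℂ) :=
  if H : ∃ v : CompactDist m, IsProduct w h.1 v.1 then H.choose.1 else 0

/-- The distribution `T` is the smooth function `g`: `T(φ) = ∫ g φ` for all compactly supported
smooth functions `φ`. -/
def IsSmoothFunction {m : ℕ} (T : 𝓢'(Euc m, ℂ)) (g : Euc m → ℂ) : Prop :=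
  ContDiff ℝ ∞ g ∧ ∀ φ : 𝓢(Euc m, ℂ), HasCompactSupport φ → T φ = ∫ x, g x * φ x

open Classical in
/-- The smooth function that the distribution `T` is. (The default value is never used for Fourier
transforms of compactly supported distributions.) -/
def toFunction {m : ℕ} (T : 𝓢'(Euc m, ℂ)) : Euc m → ℂ :=
  if H : ∃ g, IsSmoothFunction T g then H.choose else 0

/-- `F(h) = |𝓕(p) exp(α ξ²) + 𝓕(w · h)|²`. -/
def forward {m : ℕ} (w : Euc m → ℂ) (α : ℂ) (p h : CompactDist m) : Euc m → ℝ := fun ξ =>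
  ‖toFunction (fourierDist m p.1) ξ * Complex.exp (α * ((‖ξ‖ ^ 2 : ℝ) : ℂ)) +
    toFunction (fourierDist m (smoothMul w h)) ξ‖ ^ 2

/-- `F_lin(h) = |𝓕(p) exp(α ξ²) + 𝓕(w · h)|² - |𝓕(w · h)|²`. -/
def forwardLin {m : ℕ} (w : Euc m → ℂ) (α : ℂ) (p h : CompactDist m) : Euc m → ℝ := fun ξ =>
  ‖toFunction (fourierDist m p.1) ξ * Complex.exp (α * ((‖ξ‖ ^ 2 : ℝ) : ℂ)) +
    toFunction (fourierDist m (smoothMul w h)) ξ‖ ^ 2 -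
  ‖toFunction (fourierDist m (smoothMul w h)) ξ‖ ^ 2

end PhaseRetrieval

end

/-!
# Phase retrieval with a Gaussian-modulated reference wave

Let `P` and `V` be the Fourier transforms of `p` and `w · h`. On a real line `t ↦ ξ₀ + t θ` with
`θ ≠ 0` through a point `ξ₀` of the open set where the data are known, `P` and `V` extend to entire
functions of exponential type in `t`, and the reference wave is `q(t) exp (β t²)`, where
`β = α ‖θ‖²` is not real and `q` is `P` times the exponential of an affine function. Equality of
the data of two unknowns, with transforms `V` and `V'`, near `t = 0` extends by the identity
theorem to
`a(z) exp (β z²) + b(z) exp (conj β z²) + c(z) = 0` for all complex `z`, where `a`, `b`, `c` are of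
exponential type and `a(t) = q(t) conj (V(t) - V'(t))` for real `t`. Since `β` is not real, there
is a double sector in which `exp (β z²)` dominates both other terms, so `a` decays along two
lines through the origin; the Phragmén–Lindelöf principle in the four sectors between them and
Liouville's theorem give `a = 0` (`IsExpType.eq_zero_of_gaussian_combination`). Thus
`P · conj (V - V')` vanishes on all of `ℝ^m`. As `P` is not identically zero and products of
entire functions have no zero divisors, `V = V'` along every line through a point where
`P ≠ 0`, hence everywhere. Injectivity of the Fourier transform and division by `w` give `h = h'`.
For the linearized data, the same argument applies with `c = 0`.

The facts on distributions rest on a structure theorem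
(`TemperedDistribution.exists_representation`): a compactly supported `u` is a finite sum
`∑ Lᵢ ((∂^{vᵢ} φ)|_K)` with continuous functionals `Lᵢ` on `C(K, ℂ)`, `K` a closed ball. This
follows from the finite order of `u` and the Hahn–Banach theorem. The Fourier transform of `u` is
then a finite sum of polynomials times `ξ ↦ Lᵢ (exp (-i ⟨·, ξ⟩))`, where the exponential is that of
the Banach algebra `C(K, ℂ)`; smoothness, the holomorphic extension to complexified lines and the
exponential growth bound can be read off. Uniqueness statements and cutoffs use that test functions
are dense in the Schwartz space (`SchwartzMap.tendsto_smulLeftCLM_dilate`).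
-/

/-! ### Entire functions of exponential type -/

/-- Entire functions `f : ℂ → ℂ` of exponential type: `‖f z‖ ≤ A * exp (B * ‖z‖)` for some
constants `A` and `B`, here taken nonnegative for convenience. -/
def IsExpType (f : ℂ → ℂ) : Prop :=
  Differentiable ℂ f ∧ ∃ A B : ℝ, 0 ≤ A ∧ 0 ≤ B ∧ ∀ z, ‖f z‖ ≤ A * Real.exp (B * ‖z‖)

namespace IsExpType

variable {f g : ℂ → ℂ}

theorem add (hf : IsExpType f) (hg : IsExpType g) : IsExpType fun z => f z + g z := by
  obtain ⟨hfd, A, B, hA, hB, h⟩ := hf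
  obtain ⟨hgd, A', B', hA', hB', h'⟩ := hg
  refine ⟨hfd.add hgd, A + A', B + B', by positivity, by positivity, fun z => ?_⟩
  calc ‖f z + g z‖ ≤ ‖f z‖ + ‖g z‖ := norm_add_le _ _
    _ ≤ A * Real.exp (B * ‖z‖) + A' * Real.exp (B' * ‖z‖) := add_le_add (h z) (h' z)
    _ ≤ A * Real.exp ((B + B') * ‖z‖) + A' * Real.exp ((B + B') * ‖z‖) := by
      gcongr <;> linarith
    _ = _ := by ring

theorem mul (hf : IsExpType f) (hg : IsExpType g) : IsExpType fun z => f z * g z := by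
  obtain ⟨hfd, A, B, hA, hB, h⟩ := hf
  obtain ⟨hgd, A', B', hA', hB', h'⟩ := hg
  refine ⟨hfd.mul hgd, A * A', B + B', by positivity, by positivity, fun z => ?_⟩
  calc ‖f z * g z‖ = ‖f z‖ * ‖g z‖ := norm_mul _ _
    _ ≤ (A * Real.exp (B * ‖z‖)) * (A' * Real.exp (B' * ‖z‖)) := by
      gcongr
      exacts [h z, h' z]
    _ = _ := by rw [add_mul, Real.exp_add]; ring

theorem const (c : ℂ) : IsExpType fun _ => c :=
  ⟨differentiable_const c, ‖c‖, 0, norm_nonneg c, le_rfl, by simp⟩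

theorem id : IsExpType fun z => z := by
  refine ⟨differentiable_id, 1, 1, zero_le_one, zero_le_one, fun z => ?_⟩
  have := Real.add_one_le_exp ‖z‖
  simp only [one_mul]
  linarith

theorem exp_mul (c : ℂ) : IsExpType fun z => Complex.exp (c * z) := by
  refine ⟨by fun_prop, 1, ‖c‖, zero_le_one, norm_nonneg c, fun z => ?_⟩
  rw [one_mul, ← norm_mul]
  exact (Complex.norm_exp_le_exp_norm _)

theorem sub (hf : IsExpType f) (hg : IsExpType g) : IsExpType fun z => f z - g z := by
  simpa [sub_eq_add_neg] using hf.add ((const (-1)).mul hg)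

theorem sum {ι : Type*} (s : Finset ι) {F : ι → ℂ → ℂ} (hF : ∀ i ∈ s, IsExpType (F i)) :
    IsExpType fun z => ∑ i ∈ s, F i z := by
  classical
  induction s using Finset.induction_on with
  | empty => simpa using const 0
  | insert i s hi ih =>
    simp only [Finset.sum_insert hi]
    exact (hF i (by simp)).add (ih fun j hj => hF j (by simp [hj]))

theorem prod {ι : Type*} (s : Finset ι) {F : ι → ℂ → ℂ} (hF : ∀ i ∈ s, IsExpType (F i)) :
    IsExpType fun z => ∏ i ∈ s, F i z := by
  classical
  induction s using Finset.induction_on with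
  | empty => simpa using const 1
  | insert i s hi ih =>
    simp only [Finset.prod_insert hi]
    exact (hF i (by simp)).mul (ih fun j hj => hF j (by simp [hj]))

theorem comp_mul_left (hf : IsExpType f) (c : ℂ) : IsExpType fun z => f (c * z) := by
  obtain ⟨hfd, A, B, hA, hB, h⟩ := hf
  refine ⟨hfd.comp (by fun_prop), A, B * ‖c‖, hA, by positivity, fun z => ?_⟩
  simpa [mul_assoc] using h (c * z)

/-- The reflection `z ↦ conj (f (conj z))`, which on the real line is the complex conjugate
of `f`. -/
theorem conj_conj (hf : IsExpType f) :
    IsExpType fun z => starRingEnd ℂ (f (starRingEnd ℂ z)) := by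
  obtain ⟨hfd, A, B, hA, hB, h⟩ := hf
  refine ⟨fun z => ?_, A, B, hA, hB, fun z => by simpa using h (starRingEnd ℂ z)⟩
  exact differentiableAt_conj_conj_iff.2 (hfd (starRingEnd ℂ z))

/-- Phragmén–Lindelöf in a sector of opening less than `π`, in logarithmic coordinates. -/
theorem norm_le_of_sector (hf : IsExpType f) {a b C : ℝ} (hab : a < b) (hba : b - a < Real.pi)
    (ha : ∀ s : ℂ, s.im = a → ‖f (Complex.exp s)‖ ≤ C)
    (hb : ∀ s : ℂ, s.im = b → ‖f (Complex.exp s)‖ ≤ C) {s : ℂ} (has : a ≤ s.im) (hsb : s.im ≤ b) :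
    ‖f (Complex.exp s)‖ ≤ C := by
  obtain ⟨hfd, A, B, hA, hB, h⟩ := hf
  refine PhragmenLindelof.horizontal_strip (f := fun s => f (Complex.exp s)) (a := a) (b := b)
    (hfd.comp Complex.differentiable_exp).diffContOnCl ⟨1, ?_, B, ?_⟩ ha hb has hsb
  · rw [lt_div_iff₀ (by linarith)]
    linarith
  · refine Asymptotics.IsBigO.of_bound A (Filter.Eventually.of_forall fun s => ?_)
    refine (h _).trans ?_
    rw [Complex.norm_exp, Real.norm_eq_abs, abs_of_pos (Real.exp_pos _), one_mul]
    gcongr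
    exact le_abs_self _

/-- An entire function of exponential type that is bounded on two distinct lines through the
origin is bounded: the lines cut the plane into four sectors of opening less than `π`. -/
theorem norm_le_of_two_lines (hf : IsExpType f) {δ C : ℝ} (hδ : 0 < δ) (hδπ : δ < Real.pi)
    (h1 : ∀ r : ℝ, ‖f r‖ ≤ C) (h2 : ∀ r : ℝ, ‖f (r * Complex.exp (δ * Complex.I))‖ ≤ C) (z : ℂ) :
    ‖f z‖ ≤ C := by
  rcases eq_or_ne z 0 with rfl | hz
  · simpa using h1 0
  have key : ∀ s : ℂ, Complex.exp s =
      (Real.exp s.re : ℂ) * Complex.exp (s.im * Complex.I) := by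
    intro s
    rw [Complex.ofReal_exp, ← Complex.exp_add, Complex.re_add_im]
  have e0 : ∀ s : ℂ, s.im = 0 → ‖f (Complex.exp s)‖ ≤ C := by
    intro s hs
    rw [key, hs]
    simpa using h1 (Real.exp s.re)
  have eπ : ∀ s : ℂ, s.im = Real.pi → ‖f (Complex.exp s)‖ ≤ C := by
    intro s hs
    rw [key, hs, Complex.exp_pi_mul_I]
    simpa using h1 (-Real.exp s.re)
  have eπ' : ∀ s : ℂ, s.im = -Real.pi → ‖f (Complex.exp s)‖ ≤ C := by
    intro s hs
    rw [key, hs, Complex.ofReal_neg, neg_mul, Complex.exp_neg, Complex.exp_pi_mul_I]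
    simpa [inv_neg] using h1 (-Real.exp s.re)
  have eδ : ∀ s : ℂ, s.im = δ → ‖f (Complex.exp s)‖ ≤ C := by
    intro s hs
    rw [key, hs]
    exact h2 _
  have eδ' : ∀ s : ℂ, s.im = δ - Real.pi → ‖f (Complex.exp s)‖ ≤ C := by
    intro s hs
    rw [key, hs, Complex.ofReal_sub, sub_mul, Complex.exp_sub, Complex.exp_pi_mul_I, div_neg, div_one]
    simpa using h2 (-Real.exp s.re)
  have hlo := Complex.neg_pi_lt_log_im z
  have hhi := Complex.log_im_le_pi z
  rw [← Complex.exp_log hz]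
  rcases le_total (Complex.log z).im 0 with h0 | h0
  · rcases le_total (Complex.log z).im (δ - Real.pi) with h | h
    · exact hf.norm_le_of_sector (by linarith) (by linarith) eπ' eδ' hlo.le h
    · exact hf.norm_le_of_sector (by linarith) (by linarith) eδ' e0 h h0
  · rcases le_total (Complex.log z).im δ with h | h
    · exact hf.norm_le_of_sector (by linarith) (by linarith) e0 eδ h0 h
    · exact hf.norm_le_of_sector (by linarith) (by linarith) eδ eπ h hhi

theorem eq_zero_of_decay_on_two_lines (hf : IsExpType f) {δ M N : ℝ} (hδ : 0 < δ)
    (hδπ : δ < Real.pi) (h1 : ∀ r : ℝ, ‖f r‖ ≤ M * Real.exp (-|r|))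
    (h2 : ∀ r : ℝ, ‖f (r * Complex.exp (δ * Complex.I))‖ ≤ N * Real.exp (-|r|)) (z : ℂ) :
    f z = 0 := by
  have hM : 0 ≤ M := by simpa using (norm_nonneg _).trans (h1 0)
  have hN : 0 ≤ N := by simpa using (norm_nonneg _).trans (h2 0)
  have hle : ∀ r : ℝ, Real.exp (-|r|) ≤ 1 := fun r => by simp
  have hbdd : ∀ z, ‖f z‖ ≤ M + N := hf.norm_le_of_two_lines hδ hδπ
    (fun r => (h1 r).trans (by nlinarith [hle r])) (fun r => (h2 r).trans (by nlinarith [hle r]))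
  have hconst : ∀ w, f w = f z := fun w => hf.1.apply_eq_apply_of_bounded
    (isBounded_iff_forall_norm_le.2 ⟨M + N, by rintro _ ⟨z, rfl⟩; exact hbdd z⟩) w z
  have hlim : Filter.Tendsto (fun r : ℝ => M * Real.exp (-|r|)) Filter.atTop (nhds 0) := by
    simpa using ((Real.tendsto_exp_neg_atTop_nhds_zero).comp
      Filter.tendsto_abs_atTop_atTop).const_mul M
  have : ‖f z‖ ≤ 0 := ge_of_tendsto hlim
    (Filter.Eventually.of_forall fun r => by simpa [hconst r] using h1 r)
  simpa using this

/-- On a line `ℝ d` along which `exp (κ z²)` dominates both `exp (β z²)` and `1`, the coefficient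
of `exp (κ z²)` in a vanishing combination decays. -/
theorem exists_decay_of_dominant {a b c : ℂ → ℂ} (hb : IsExpType b) (hc : IsExpType c)
    {κ β : ℂ} (habc : ∀ z, a z * Complex.exp (κ * z ^ 2) + b z * Complex.exp (β * z ^ 2) + c z = 0)
    {d : ℂ} (hd0 : 0 < (κ * d ^ 2).re) (hd : (β * d ^ 2).re < (κ * d ^ 2).re) :
    ∃ M : ℝ, ∀ r : ℝ, ‖a (r * d)‖ ≤ M * Real.exp (-|r|) := by
  -- A Gaussian absorbs any exponential.
  have gauss : ∀ {q : ℝ}, 0 < q → ∀ {g : ℂ → ℂ}, IsExpType g →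
      ∃ M : ℝ, ∀ r : ℝ, ‖g (r * d)‖ * Real.exp (-q * r ^ 2) ≤ M * Real.exp (-|r|) := by
    rintro q hq g ⟨-, A, B, hA, hB, h⟩
    refine ⟨A * Real.exp ((B * ‖d‖ + 1) ^ 2 / (4 * q)), fun r => ?_⟩
    calc ‖g (r * d)‖ * Real.exp (-q * r ^ 2)
        ≤ A * Real.exp (B * ‖(r * d : ℂ)‖) * Real.exp (-q * r ^ 2) := by gcongr; exact h _
      _ = A * Real.exp (B * (|r| * ‖d‖) + -q * r ^ 2) := by
          rw [Real.exp_add, norm_mul, Complex.norm_real, Real.norm_eq_abs, mul_assoc]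
      _ ≤ A * Real.exp ((B * ‖d‖ + 1) ^ 2 / (4 * q) + -|r|) := by
          refine mul_le_mul_of_nonneg_left (Real.exp_le_exp.2 ?_) hA
          have h4 : 0 ≤ (2 * q * |r| - (B * ‖d‖ + 1)) ^ 2 / (4 * q) := by positivity
          have : (2 * q * |r| - (B * ‖d‖ + 1)) ^ 2 / (4 * q) =
              q * r ^ 2 - (B * ‖d‖ + 1) * |r| + (B * ‖d‖ + 1) ^ 2 / (4 * q) := by
            rw [← sq_abs r]
            field_simp
            ring
          linarith
      _ = _ := by rw [Real.exp_add]; ring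
  obtain ⟨M, hM⟩ := gauss (sub_pos.2 hd) hb
  obtain ⟨N, hN⟩ := gauss hd0 hc
  refine ⟨M + N, fun r => ?_⟩
  have hre : ∀ γ : ℂ, (γ * (r * d) ^ 2).re = (γ * d ^ 2).re * r ^ 2 := by
    intro γ
    rw [show γ * (r * d) ^ 2 = (γ * d ^ 2) * ((r ^ 2 : ℝ) : ℂ) by push_cast; ring,
      Complex.re_mul_ofReal]
  have heq : a (r * d) = -(b (r * d) * Complex.exp (β * (r * d) ^ 2 - κ * (r * d) ^ 2)
      + c (r * d) * Complex.exp (-(κ * (r * d) ^ 2))) := by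
    have h := habc (r * d)
    have hne := Complex.exp_ne_zero (κ * (r * d) ^ 2)
    generalize κ * (r * d) ^ 2 = x at *
    generalize β * (r * d) ^ 2 = y at *
    rw [Complex.exp_sub, Complex.exp_neg]
    field_simp
    linear_combination h
  rw [heq, norm_neg]
  refine (norm_add_le _ _).trans ?_
  rw [add_mul]
  refine add_le_add ?_ ?_
  · rw [norm_mul, Complex.norm_exp, Complex.sub_re, hre, hre]
    rw [← sub_mul, ← neg_sub]
    exact hM r
  · rw [norm_mul, Complex.norm_exp, Complex.neg_re, hre]
    rw [← neg_mul]
    exact hN r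

/-- Over the functions of exponential type, `exp (α z²)` is not a combination of `exp (ᾱ z²)` and
`1` when `α` is not real: there is a double sector in which `exp (α z²)` dominates the other two,
so its coefficient decays along two lines. -/
theorem eq_zero_of_gaussian_combination {a b c : ℂ → ℂ} (ha : IsExpType a) (hb : IsExpType b)
    (hc : IsExpType c) {α : ℂ} (hα : α.im ≠ 0)
    (habc : ∀ z, a z * Complex.exp (α * z ^ 2) + b z * Complex.exp (starRingEnd ℂ α * z ^ 2)
      + c z = 0) (z : ℂ) : a z = 0 := by
  -- Rotate by a square root `σ` of `conj α`: then `α (σ z)² = |α|² z²`.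
  obtain ⟨σ, hσ⟩ := IsAlgClosed.exists_pow_nat_eq (starRingEnd ℂ α) (n := 2) two_pos
  have hα0 : α ≠ 0 := by rintro rfl; simp at hα
  have hσ0 : σ ≠ 0 := by
    rintro rfl
    exact hα0 (by simpa using hσ.symm)
  have habc' : ∀ z, a (σ * z) * Complex.exp (α * σ ^ 2 * z ^ 2) +
      b (σ * z) * Complex.exp (starRingEnd ℂ α * σ ^ 2 * z ^ 2) + c (σ * z) = 0 := by
    intro z
    have := habc (σ * z)
    rwa [mul_pow, ← mul_assoc, ← mul_assoc] at this
  have hκ : 0 < (α * σ ^ 2).re := by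
    rw [hσ, Complex.mul_conj, Complex.ofReal_re]
    exact Complex.normSq_pos.2 hα0
  have hβ : (starRingEnd ℂ α * σ ^ 2).re < (α * σ ^ 2).re := by
    rw [hσ]
    simp only [Complex.mul_re, Complex.conj_re, Complex.conj_im]
    nlinarith [sq_pos_of_ne_zero hα]
  -- The inequalities persist in all directions close to `1`.
  have hopen : ∀ᶠ δ : ℝ in nhds 0,
      0 < (α * σ ^ 2 * Complex.exp (δ * Complex.I) ^ 2).re ∧
      (starRingEnd ℂ α * σ ^ 2 * Complex.exp (δ * Complex.I) ^ 2).re <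
        (α * σ ^ 2 * Complex.exp (δ * Complex.I) ^ 2).re := by
    refine Filter.Eventually.and ?_ ?_
    · exact (by fun_prop : Continuous fun δ : ℝ =>
        (α * σ ^ 2 * Complex.exp (δ * Complex.I) ^ 2).re).continuousAt.eventually_const_lt
          (by simpa using hκ)
    · exact (by fun_prop : Continuous fun δ : ℝ =>
        (starRingEnd ℂ α * σ ^ 2 * Complex.exp (δ * Complex.I) ^ 2).re).continuousAt.eventually_lt
        (by fun_prop : Continuous fun δ : ℝ =>
          (α * σ ^ 2 * Complex.exp (δ * Complex.I) ^ 2).re).continuousAt (by simpa using hβ)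
  obtain ⟨δ, ⟨h0, h1⟩, hδπ, hδ⟩ := ((hopen.filter_mono nhdsWithin_le_nhds).and
    (Ioo_mem_nhdsGT Real.pi_pos)).exists.imp fun δ h => (⟨h.1, h.2.2, h.2.1⟩ :
      (_ ∧ _) ∧ δ < Real.pi ∧ 0 < δ)
  obtain ⟨M, hM⟩ := exists_decay_of_dominant (hb.comp_mul_left σ) (hc.comp_mul_left σ) habc'
    (d := 1) (by simpa using hκ) (by simpa using hβ)
  obtain ⟨N, hN⟩ := exists_decay_of_dominant (hb.comp_mul_left σ) (hc.comp_mul_left σ) habc' h0 h1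
  have := (ha.comp_mul_left σ).eq_zero_of_decay_on_two_lines hδ hδπ
    (fun r => by simpa using hM r) hN (σ⁻¹ * z)
  simpa [hσ0] using this

end IsExpType

/-- Two entire functions that agree at the real points near `0` are equal. -/
theorem Differentiable.eq_of_eventually_eq_ofReal {f g : ℂ → ℂ} (hf : Differentiable ℂ f)
    (hg : Differentiable ℂ g) (h : ∀ᶠ t : ℝ in nhds 0, f t = g t) : f = g := by
  refine AnalyticOnNhd.eq_of_frequently_eq (z₀ := 0) (𝕜 := ℂ)
    (fun z _ => hf.analyticAt z) (fun z _ => hg.analyticAt z) ?_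
  have ht : Filter.Tendsto (fun t : ℝ => (t : ℂ)) (nhdsWithin 0 {0}ᶜ) (nhdsWithin 0 {0}ᶜ) := by
    refine tendsto_nhdsWithin_iff.2 ⟨?_, ?_⟩
    · exact (Complex.continuous_ofReal.tendsto' 0 0 (by simp)).mono_left nhdsWithin_le_nhds
    · filter_upwards [self_mem_nhdsWithin] with t ht
      simpa using ht
  exact ht.frequently (h.filter_mono nhdsWithin_le_nhds).frequently

/-! ### Test functions and the support of a tempered distribution -/

section Support

open Filter Topology

variable {E : Type*} [NormedAddCommGroup E] [NormedSpace ℝ E]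

theorem ContDiff.exists_norm_iteratedFDeriv_le {χ : E → ℂ} (hχ : ContDiff ℝ ∞ χ)
    (hc : HasCompactSupport χ) : ∃ M : ℕ → ℝ, ∀ j x, ‖iteratedFDeriv ℝ j χ x‖ ≤ M j := by
  have : ∀ j, ∃ C, ∀ x, ‖iteratedFDeriv ℝ j χ x‖ ≤ C := fun j =>
    (hc.iteratedFDeriv j).exists_bound_of_continuous
      (hχ.continuous_iteratedFDeriv (by exact_mod_cast le_top))
  choose M hM using this
  exact ⟨M, hM⟩

theorem SchwartzMap.norm_iteratedFDeriv_smulLeftCLM_le {χ : E → ℂ} (hχ : χ.HasTemperateGrowth)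
    {M : ℕ → ℝ} (hM : ∀ j x, ‖iteratedFDeriv ℝ j χ x‖ ≤ M j) (φ : 𝓢(E, ℂ)) (n : ℕ) (x : E) :
    ‖iteratedFDeriv ℝ n (SchwartzMap.smulLeftCLM ℂ χ φ) x‖ ≤
      ∑ i ∈ Finset.range (n + 1), (n.choose i : ℝ) * M i * ‖iteratedFDeriv ℝ (n - i) φ x‖ := by
  rw [SchwartzMap.smulLeftCLM_apply hχ]
  refine (norm_iteratedFDeriv_smul_le hχ.1 (φ.smooth ⊤) x (by exact_mod_cast le_top)).trans ?_
  gcongr with i _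
  exact hM i x

theorem TemperedDistribution.exists_dsupport_subset_ball {u : 𝓢'(E, ℂ)} (hu : IsCompact (dsupport u)) :
    ∃ R, dsupport u ⊆ Metric.ball 0 R :=
  hu.isBounded.subset_ball 0

/-- Compactly supported smooth functions are dense in the Schwartz space: the truncations
`χ (x / (k + 1)) φ x` converge to `φ`. -/
theorem SchwartzMap.tendsto_smulLeftCLM_dilate {χ : E → ℂ} (hχ : ContDiff ℝ ∞ χ)
    (hc : HasCompactSupport χ) (h1 : ∀ x ∈ Metric.ball 0 1, χ x = 1) (φ : 𝓢(E, ℂ)) :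
    Tendsto (fun k : ℕ =>
      SchwartzMap.smulLeftCLM ℂ (fun x => χ (((k : ℝ) + 1)⁻¹ • x)) φ) atTop (𝓝 φ) := by
  obtain ⟨M, hM⟩ := hχ.exists_norm_iteratedFDeriv_le hc
  have htg : ∀ k : ℕ, (fun x => χ (((k : ℝ) + 1)⁻¹ • x)).HasTemperateGrowth := fun k =>
    HasCompactSupport.hasTemperateGrowth (hc.comp_smul (by positivity)) (by fun_prop)
  -- Dilating by a factor at most `1` does not increase the derivatives of the cutoff.
  have hMk : ∀ (k j : ℕ) (x : E),
      ‖iteratedFDeriv ℝ j (fun x => χ (((k : ℝ) + 1)⁻¹ • x)) x‖ ≤ M j := by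
    intro k j x
    rw [iteratedFDeriv_comp_const_smul _ (hχ.of_le (by exact_mod_cast le_top)), norm_smul, norm_pow]
    have h2 : ‖((k : ℝ) + 1)⁻¹‖ ≤ 1 := by
      rw [norm_inv, Real.norm_of_nonneg (by positivity)]
      exact inv_le_one_of_one_le₀ (by linarith [k.cast_nonneg (α := ℝ)])
    calc _ ≤ 1 * ‖iteratedFDeriv ℝ j χ (((k : ℝ) + 1)⁻¹ • x)‖ := by
          gcongr
          exact pow_le_one₀ (norm_nonneg _) h2
      _ ≤ M j := by rw [one_mul]; exact hM _ _
  have hM0 : ∀ j, 0 ≤ M j := fun j => (norm_nonneg _).trans (hM j 0)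
  rw [(schwartz_withSeminorms ℂ E ℂ).tendsto_nhds]
  rintro ⟨p, n⟩ ε hε
  set K : ℝ := (∑ i ∈ Finset.range (n + 1), (n.choose i : ℝ) * M i *
    SchwartzMap.seminorm ℂ (p + 1) (n - i) φ) + SchwartzMap.seminorm ℂ (p + 1) n φ with hK
  have hK0 : 0 ≤ K := by
    refine add_nonneg (Finset.sum_nonneg fun i _ => ?_) (apply_nonneg _ _)
    exact mul_nonneg (mul_nonneg (by positivity) (hM0 i)) (apply_nonneg _ _)
  have hbound : ∀ k : ℕ, SchwartzMap.seminorm ℂ p n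
      (SchwartzMap.smulLeftCLM ℂ (fun x => χ (((k : ℝ) + 1)⁻¹ • x)) φ - φ) ≤ K / (k + 1) := by
    intro k
    have hk : (0 : ℝ) < k + 1 := by positivity
    refine SchwartzMap.seminorm_le_bound ℂ p n _ (by positivity) fun x => ?_
    rcases lt_or_ge ‖x‖ (k + 1) with hx | hx
    · have : (⇑(SchwartzMap.smulLeftCLM ℂ (fun x => χ (((k : ℝ) + 1)⁻¹ • x)) φ - φ))
          =ᶠ[𝓝 x] fun _ => (0 : ℂ) := by
        filter_upwards [(isOpen_lt continuous_norm continuous_const).mem_nhds hx] with y hy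
        rw [sub_apply, SchwartzMap.smulLeftCLM_apply_apply (htg k), h1, one_smul,
          sub_self]
        rw [mem_ball_zero_iff, norm_smul, norm_inv, Real.norm_of_nonneg hk.le,
          inv_mul_lt_iff₀ hk, mul_one]
        exact hy
      have hz : iteratedFDeriv ℝ n
          (⇑(SchwartzMap.smulLeftCLM ℂ (fun x => χ (((k : ℝ) + 1)⁻¹ • x)) φ - φ)) x = 0 := by
        by_contra hne
        exact notMem_tsupport_iff_eventuallyEq.2 this (support_iteratedFDeriv_subset n hne)
      rw [hz]
      rw [norm_zero, mul_zero]
      positivity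
    · rw [le_div_iff₀ hk]
      have hd : ‖iteratedFDeriv ℝ n
          (⇑(SchwartzMap.smulLeftCLM ℂ (fun x => χ (((k : ℝ) + 1)⁻¹ • x)) φ - φ)) x‖ ≤
          (∑ i ∈ Finset.range (n + 1), (n.choose i : ℝ) * M i * ‖iteratedFDeriv ℝ (n - i) φ x‖) +
            ‖iteratedFDeriv ℝ n φ x‖ := by
        have hco : (⇑(SchwartzMap.smulLeftCLM ℂ (fun x => χ (((k : ℝ) + 1)⁻¹ • x)) φ - φ)) =
            ⇑(SchwartzMap.smulLeftCLM ℂ (fun x => χ (((k : ℝ) + 1)⁻¹ • x)) φ) - ⇑φ := rfl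
        rw [hco, iteratedFDeriv_sub_apply
          ((SchwartzMap.smooth _ n).contDiffAt) ((SchwartzMap.smooth _ n).contDiffAt)]
        refine (norm_sub_le _ _).trans ?_
        gcongr
        exact SchwartzMap.norm_iteratedFDeriv_smulLeftCLM_le (htg k) (hMk k) φ n x
      calc _ ≤ ‖x‖ ^ p * ((∑ i ∈ Finset.range (n + 1),
            (n.choose i : ℝ) * M i * ‖iteratedFDeriv ℝ (n - i) φ x‖) +
            ‖iteratedFDeriv ℝ n φ x‖) * ‖x‖ :=
            mul_le_mul (mul_le_mul_of_nonneg_left hd (by positivity)) hx hk.le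
              (mul_nonneg (by positivity) ((norm_nonneg _).trans hd))
        _ = (∑ i ∈ Finset.range (n + 1), (n.choose i : ℝ) * M i *
              (‖x‖ ^ (p + 1) * ‖iteratedFDeriv ℝ (n - i) φ x‖)) +
            ‖x‖ ^ (p + 1) * ‖iteratedFDeriv ℝ n φ x‖ := by
          rw [mul_right_comm, ← pow_succ, mul_add, Finset.mul_sum]
          congr 1
          refine Finset.sum_congr rfl fun i _ => by ring
        _ ≤ K := by
          rw [hK]
          gcongr with i _
          · exact mul_nonneg (by positivity) (hM0 i)
          · exact SchwartzMap.le_seminorm ℂ _ _ φ x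
          · exact SchwartzMap.le_seminorm ℂ _ _ φ x
  have hlim : Tendsto (fun k : ℕ => K / ((k : ℝ) + 1)) atTop (𝓝 0) := by
    simpa [div_eq_mul_inv] using (tendsto_one_div_add_atTop_nhds_zero_nat (𝕜 := ℝ)).const_mul K
  filter_upwards [hlim.eventually_lt_const hε] with k hk
  exact (hbound k).trans_lt hk

variable [FiniteDimensional ℝ E]

/-- A smooth cutoff function, equal to `1` on a prescribed ball. -/
theorem exists_smooth_cutoff (R : ℝ) :
    ∃ χ : E → ℂ, ContDiff ℝ ∞ χ ∧ HasCompactSupport χ ∧ ∀ x ∈ Metric.ball 0 R, χ x = 1 := by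
  let b : ContDiffBump (0 : E) := ⟨max R 1, max R 1 + 1, by positivity, by linarith⟩
  refine ⟨fun x => (b x : ℂ), Complex.ofRealCLM.contDiff.comp b.contDiff,
    b.hasCompactSupport.comp_left (g := Complex.ofReal) rfl, fun x hx => ?_⟩
  change ((b x : ℝ) : ℂ) = 1
  rw [b.one_of_mem_closedBall, Complex.ofReal_one]
  exact Metric.closedBall_subset_closedBall (le_max_left _ _) (Metric.ball_subset_closedBall hx)

namespace TemperedDistribution

theorem apply_eq_zero_of_tsupport_subset_of_hasCompactSupport (u : 𝓢'(E, ℂ)) {φ : 𝓢(E, ℂ)}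
    (hφ : HasCompactSupport φ) (hs : tsupport φ ⊆ (dsupport u)ᶜ) : u φ = 0 := by
  have hcov : ∀ x : tsupport φ, ∃ s : Set E, IsVanishingOn u s ∧ IsOpen s ∧ (x : E) ∈ s := fun x =>
    notMem_dsupport_iff (x : E) |>.1 (hs x.2)
  choose U hUv hUo hxU using hcov
  obtain ⟨t, ht⟩ := hφ.isCompact.elim_finite_subcover U hUo
    fun x hx => Set.mem_iUnion.2 ⟨⟨x, hx⟩, hxU ⟨x, hx⟩⟩
  obtain ⟨ρ, hρ⟩ := SmoothPartitionOfUnity.exists_isSubordinate (modelWithCornersSelf ℝ E)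
    (isClosed_tsupport φ) (fun i : t => U i) (fun i => hUo i)
    (by simpa [Set.iUnion_subtype] using ht)
  have hρs : ∀ i, ContDiff ℝ ∞ fun x => (ρ i x : ℂ) := fun i =>
    Complex.ofRealCLM.contDiff.comp (ρ i).contMDiff.contDiff
  have hsupp : ∀ i, HasCompactSupport fun x => (ρ i x : ℂ) * φ x := fun i => hφ.mul_left
  let ψ : t → 𝓢(E, ℂ) := fun i => (hsupp i).toSchwartzMap ((hρs i).mul (φ.smooth ⊤))
  have hsum : φ = ∑ i, ψ i := by
    ext x
    rw [sum_apply]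
    change φ x = ∑ i, (ρ i x : ℂ) * φ x
    rw [← Finset.sum_mul]
    by_cases hx : x ∈ tsupport φ
    · have := ρ.sum_eq_one hx
      rw [finsum_eq_sum_of_fintype] at this
      rw [← Complex.ofReal_sum, this, Complex.ofReal_one, one_mul]
    · rw [image_eq_zero_of_notMem_tsupport hx, mul_zero]
  rw [hsum, map_sum]
  refine Finset.sum_eq_zero fun i _ => hUv i (ψ i) ?_
  refine (tsupport_mul_subset_left (f := fun x => (ρ i x : ℂ)) (g := φ)).trans ?_
  exact (tsupport_comp_subset (g := Complex.ofReal) Complex.ofReal_zero _).trans (hρ i)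

/-- A tempered distribution vanishes on the complement of its support. Test functions need not be
compactly supported here, so this uses a partition of unity and the density of the compactly
supported functions. -/
theorem isVanishingOn_compl_dsupport (u : 𝓢'(E, ℂ)) :
    IsVanishingOn u (dsupport u)ᶜ := by
  intro φ hφ
  obtain ⟨χ, hχ, hc, h1⟩ := exists_smooth_cutoff (E := E) 1
  have h := ((map_continuous u).tendsto φ).comp
    (SchwartzMap.tendsto_smulLeftCLM_dilate hχ hc h1 φ)
  refine tendsto_nhds_unique h ?_
  refine tendsto_const_nhds.congr fun k => ?_
  have hck : HasCompactSupport fun x => χ (((k : ℝ) + 1)⁻¹ • x) := hc.comp_smul (by positivity)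
  have hsub := SchwartzMap.tsupport_smulLeftCLM_subset (fun x => χ (((k : ℝ) + 1)⁻¹ • x)) φ
  refine (apply_eq_zero_of_tsupport_subset_of_hasCompactSupport u ?_ ?_).symm
  · exact hck.of_isClosed_subset (isClosed_tsupport _) (hsub.trans Set.inter_subset_right)
  · exact (hsub.trans Set.inter_subset_left).trans hφ

theorem apply_eq_of_eqOn_ball {u : 𝓢'(E, ℂ)} {R : ℝ}
    (hu : dsupport u ⊆ Metric.ball 0 R) {φ ψ : 𝓢(E, ℂ)}
    (h : Set.EqOn φ ψ (Metric.ball 0 R)) : u φ = u ψ := by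
  rw [← sub_eq_zero, ← map_sub]
  refine isVanishingOn_compl_dsupport u _ ?_
  refine (closure_minimal (fun x hx => ?_) Metric.isOpen_ball.isClosed_compl).trans
    (Set.compl_subset_compl.2 hu)
  intro hxR
  exact hx (by rw [sub_apply, h hxR, sub_self])

end TemperedDistribution

end Support

/-! ### Compactly supported distributions as finite sums of derivatives of functionals -/

section Representation

open Filter Topology
open scoped LineDeriv

variable {E : Type*} [NormedAddCommGroup E] [InnerProductSpace ℝ E]

/-- The norm of a multilinear map is controlled by its values on an orthonormal basis. -/
theorem ContinuousMultilinearMap.norm_le_sum_basis {ι : Type*} [Fintype ι]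
    (b : OrthonormalBasis ι ℝ E) {n : ℕ} (T : E [×n]→L[ℝ] ℂ) :
    ‖T‖ ≤ ∑ f : Fin n → ι, ‖T fun j => b (f j)‖ := by
  classical
  refine T.opNorm_le_bound (by positivity) fun v => ?_
  have hv : T v = ∑ f : Fin n → ι, T fun j => (inner ℝ (b (f j)) (v j)) • b (f j) := by
    rw [← T.map_sum fun j k => (inner ℝ (b k) (v j)) • b k]
    congr 1
    funext j
    exact (b.sum_repr' (v j)).symm
  rw [hv, Finset.sum_mul]
  refine (norm_sum_le _ _).trans (Finset.sum_le_sum fun f _ => ?_)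
  rw [T.map_smul_univ, norm_smul, mul_comm, norm_prod]
  gcongr with j
  exact (norm_inner_le_norm _ _).trans (by simp)

/-- A linear form dominated by the norm of a linear map factors continuously through it
(Hahn–Banach). -/
theorem exists_eq_comp_of_norm_le {V B : Type*} [AddCommGroup V] [Module ℂ V]
    [NormedAddCommGroup B] [NormedSpace ℂ B] (J : V →ₗ[ℂ] B) (u : V →ₗ[ℂ] ℂ) {C : ℝ}
    (h : ∀ v, ‖u v‖ ≤ C * ‖J v‖) : ∃ L : B →L[ℂ] ℂ, ∀ v, u v = L (J v) := by
  have hker : LinearMap.ker J ≤ LinearMap.ker u := fun v hv => by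
    rw [LinearMap.mem_ker] at hv ⊢
    simpa [hv] using h v
  let e := J.quotKerEquivRange
  let l : LinearMap.range J →ₗ[ℂ] ℂ := ((LinearMap.ker J).liftQ u hker) ∘ₗ e.symm.toLinearMap
  have hl : ∀ v, l ⟨J v, v, rfl⟩ = u v := by
    intro v
    have : e.symm ⟨J v, v, rfl⟩ = (LinearMap.ker J).mkQ v := by
      rw [LinearEquiv.symm_apply_eq]
      rfl
    simp only [l, LinearMap.comp_apply, LinearEquiv.coe_coe, this, Submodule.mkQ_apply,
      Submodule.liftQ_apply]
  let lc : StrongDual ℂ (LinearMap.range J) := l.mkContinuous C (by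
    rintro ⟨_, v, rfl⟩
    rw [hl]
    exact h v)
  obtain ⟨L, hL, -⟩ := exists_extension_norm_eq _ lc
  exact ⟨L, fun v => by rw [hL ⟨J v, v, rfl⟩]; exact (hl v).symm⟩

variable [FiniteDimensional ℝ E]

/-- A compactly supported distribution has finite order on a ball containing its support. -/
theorem TemperedDistribution.exists_finite_order {u : 𝓢'(E, ℂ)} (hu : IsCompact (dsupport u)) :
    ∃ (r : ℝ) (N : ℕ) (C : ℝ), 0 ≤ C ∧ ∀ (φ : 𝓢(E, ℂ)) (M : ℝ), 0 ≤ M →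
      (∀ n ≤ N, ∀ x ∈ Metric.closedBall (0 : E) r, ‖iteratedFDeriv ℝ n φ x‖ ≤ M) →
        ‖u φ‖ ≤ C * M := by
  obtain ⟨R, hR⟩ := exists_dsupport_subset_ball hu
  obtain ⟨χ, hχ, hc, h1⟩ := exists_smooth_cutoff (E := E) R
  obtain ⟨D, hD⟩ := hχ.exists_norm_iteratedFDeriv_le hc
  have hD0 : ∀ j, 0 ≤ D j := fun j => (norm_nonneg _).trans (hD j 0)
  have htg := hc.hasTemperateGrowth hχ
  obtain ⟨r, hr⟩ := hc.isCompact.isBounded.subset_closedBall 0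
  obtain ⟨s, C, -, hC⟩ := Seminorm.bound_of_continuous (schwartz_withSeminorms ℂ E ℂ)
    ((normSeminorm ℂ ℂ).comp u.toLinearMap) (continuous_norm.comp (map_continuous u))
  set B : ℕ × ℕ → ℝ := fun i =>
    |r| ^ i.1 * ∑ j ∈ Finset.range (i.2 + 1), (i.2.choose j : ℝ) * D j with hB
  have hB0 : ∀ i, 0 ≤ B i := fun i =>
    mul_nonneg (by positivity) (Finset.sum_nonneg fun j _ => mul_nonneg (by positivity) (hD0 j))
  refine ⟨r, s.sup Prod.snd, C * ∑ i ∈ s, B i,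
    mul_nonneg C.2 (Finset.sum_nonneg fun i _ => hB0 i), fun φ M hM hφ => ?_⟩
  have hcut : u (SchwartzMap.smulLeftCLM ℂ χ φ) = u φ := apply_eq_of_eqOn_ball hR fun x hx => by
    rw [SchwartzMap.smulLeftCLM_apply_apply htg, h1 x hx, one_smul]
  rw [← hcut, mul_assoc]
  refine (hC _).trans ?_
  change C * (s.sup (schwartzSeminormFamily ℂ E ℂ)) _ ≤ _
  refine mul_le_mul_of_nonneg_left ?_ C.2
  have hsum0 : 0 ≤ ∑ i ∈ s, B i := Finset.sum_nonneg fun i _ => hB0 i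
  refine Seminorm.finset_sup_apply_le (by positivity) fun i hi => ?_
  refine le_trans ?_ (mul_le_mul_of_nonneg_right
    (Finset.single_le_sum (fun j _ => hB0 j) hi) hM)
  refine SchwartzMap.seminorm_le_bound ℂ i.1 i.2 _ (mul_nonneg (hB0 i) hM) fun x => ?_
  by_cases hx : x ∈ tsupport χ
  · have hxr := hr hx
    calc _ ≤ |r| ^ i.1 * ∑ j ∈ Finset.range (i.2 + 1),
            (i.2.choose j : ℝ) * D j * ‖iteratedFDeriv ℝ (i.2 - j) φ x‖ := by
          gcongr
          · exact (mem_closedBall_zero_iff.1 hxr).trans (le_abs_self r)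
          · exact SchwartzMap.norm_iteratedFDeriv_smulLeftCLM_le htg hD φ i.2 x
      _ ≤ |r| ^ i.1 * ∑ j ∈ Finset.range (i.2 + 1), (i.2.choose j : ℝ) * D j * M := by
          gcongr with j _
          · exact mul_nonneg (by positivity) (hD0 j)
          · exact hφ _ ((Nat.sub_le _ _).trans (Finset.le_sup (f := Prod.snd) hi)) x hxr
      _ = B i * M := by rw [hB, ← Finset.sum_mul, mul_assoc]
  · have hz : iteratedFDeriv ℝ i.2 (SchwartzMap.smulLeftCLM ℂ χ φ) x = 0 := by
      by_contra hne
      exact hx (SchwartzMap.tsupport_smulLeftCLM_subset χ φ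
        (support_iteratedFDeriv_subset i.2 hne)).2
    rw [hz, norm_zero, mul_zero]
    exact mul_nonneg (hB0 i) hM

/-- Structure theorem: a compactly supported distribution is a finite sum of derivatives of
continuous functionals on `C(K, ℂ)`, for a closed ball `K`. -/
theorem TemperedDistribution.exists_representation {u : 𝓢'(E, ℂ)} (hu : IsCompact (dsupport u)) :
    ∃ (r : ℝ) (ι : Type) (_ : Fintype ι) (n : ι → ℕ) (v : ∀ i, Fin (n i) → E)
      (L : ι → C(Metric.closedBall (0 : E) r, ℂ) →L[ℂ] ℂ),
      ∀ φ : 𝓢(E, ℂ), u φ =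
        ∑ i, L i ((∂^{v i} φ).toContinuousMap.restrict (Metric.closedBall 0 r)) := by
  classical
  obtain ⟨r, N, C, hC, hbound⟩ := exists_finite_order hu
  let b := stdOrthonormalBasis ℝ E
  let ι := Σ n : Fin (N + 1), (Fin n → Fin (Module.finrank ℝ E))
  let v : ∀ i : ι, Fin i.1 → E := fun i j => b (i.2 j)
  have : CompactSpace (Metric.closedBall (0 : E) r) :=
    isCompact_iff_compactSpace.1 (isCompact_closedBall _ _)
  let J : 𝓢(E, ℂ) →ₗ[ℂ] (ι → C(Metric.closedBall (0 : E) r, ℂ)) :=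
    { toFun := fun φ i => (∂^{v i} φ).toContinuousMap.restrict (Metric.closedBall 0 r)
      map_add' := fun φ ψ => by
        funext i
        ext x
        have := congrArg (fun f : 𝓢(E, ℂ) => f x)
          (LineDeriv.iteratedLineDerivOp_add (v i) φ ψ)
        exact this
      map_smul' := fun c φ => by
        funext i
        ext x
        have := congrArg (fun f : 𝓢(E, ℂ) => f x)
          (LineDeriv.iteratedLineDerivOp_smul (v i) c φ)
        exact this }
  have hJ : ∀ φ, ‖u φ‖ ≤ C * Fintype.card ι * ‖J φ‖ := by
    intro φ
    rw [mul_assoc]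
    refine hbound φ _ (by positivity) fun n hn x hx => ?_
    refine (ContinuousMultilinearMap.norm_le_sum_basis b _).trans ?_
    have hterm : ∀ f : Fin n → Fin (Module.finrank ℝ E),
        ‖iteratedFDeriv ℝ n φ x fun j => b (f j)‖ ≤ ‖J φ‖ := by
      intro f
      let i : ι := ⟨⟨n, by omega⟩, f⟩
      rw [← SchwartzMap.iteratedLineDerivOp_eq_iteratedFDeriv]
      exact ((J φ i).norm_coe_le_norm ⟨x, hx⟩).trans (norm_le_pi_norm (J φ) i)
    refine (Finset.sum_le_sum fun f _ => hterm f).trans ?_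
    rw [Finset.sum_const, nsmul_eq_mul]
    gcongr
    rw [Finset.card_univ]
    exact Fintype.card_le_of_injective
      (fun f : Fin n → Fin (Module.finrank ℝ E) => (⟨⟨n, by omega⟩, f⟩ : ι))
      fun f g h => eq_of_heq (Sigma.mk.inj h).2
  obtain ⟨L, hL⟩ := exists_eq_comp_of_norm_le J u.toLinearMap hJ
  refine ⟨r, ι, inferInstance, fun i => i.1, v, fun i =>
    L.comp (ContinuousLinearMap.single ℂ (fun _ : ι => C(Metric.closedBall (0 : E) r, ℂ)) i),
    fun φ => ?_⟩
  refine (hL φ).trans ?_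
  conv_lhs =>
    rw [← LinearMap.sum_single_apply (fun _ : ι => C(Metric.closedBall (0 : E) r, ℂ)) (J φ)]
  rw [map_sum]
  rfl

end Representation

/-! ### The Fourier transform of a compactly supported distribution -/

section Exponentials

variable {K : Type*} [TopologicalSpace K] [CompactSpace K]

theorem ContinuousMap.exp_apply_complex (a : C(K, ℂ)) (x : K) :
    NormedSpace.exp a x = Complex.exp (a x) := by
  rw [Complex.exp_eq_exp_ℂ]
  exact NormedSpace.map_exp_of_mem_ball (𝕂 := ℂ) (ContinuousMap.evalAlgHom ℂ ℂ x)
    (continuous_eval_const x) a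
    ((NormedSpace.expSeries_radius_eq_top ℂ C(K, ℂ)).symm ▸ edist_lt_top _ _)

theorem ContinuousMap.norm_exp_le_complex (a : C(K, ℂ)) :
    ‖NormedSpace.exp a‖ ≤ Real.exp ‖a‖ := by
  refine (ContinuousMap.norm_le _ (Real.exp_pos _).le).2 fun x => ?_
  rw [ContinuousMap.exp_apply_complex]
  exact (Complex.norm_exp_le_exp_norm _).trans (Real.exp_le_exp.2 (a.norm_coe_le_norm x))

theorem IsExpType.clm_exp (L : C(K, ℂ) →L[ℂ] ℂ) (a b : C(K, ℂ)) :
    IsExpType fun z => L (NormedSpace.exp (a + z • b)) := by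
  refine ⟨fun z => ?_, ‖L‖ * Real.exp ‖a‖, ‖b‖, by positivity, by positivity, fun z => ?_⟩
  · have h : DifferentiableAt ℂ (NormedSpace.exp : C(K, ℂ) → C(K, ℂ)) (a + z • b) :=
      (NormedSpace.exp_analytic (𝕂 := ℂ) (a + z • b)).differentiableAt
    exact L.differentiableAt.comp z (h.comp z (by fun_prop))
  · calc _ ≤ ‖L‖ * ‖NormedSpace.exp (a + z • b)‖ := L.le_opNorm _
      _ ≤ ‖L‖ * Real.exp (‖a‖ + ‖b‖ * ‖z‖) := by
        refine mul_le_mul_of_nonneg_left ((ContinuousMap.norm_exp_le_complex _).trans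
          (Real.exp_le_exp.2 ((norm_add_le _ _).trans ?_))) (norm_nonneg _)
        rw [norm_smul, mul_comm ‖z‖]
      _ = _ := by rw [Real.exp_add, mul_assoc]

end Exponentials

namespace PhaseRetrieval

open scoped LineDeriv

variable {m : ℕ}

/-- The phase function `x ↦ -i ⟨x, ξ⟩` on a closed ball, as a linear function of `ξ`. -/
noncomputable def phase (m : ℕ) (r : ℝ) : Euc m →ₗ[ℝ] C(Metric.closedBall (0 : Euc m) r, ℂ) where
  toFun ξ := ⟨fun x => -Complex.I * (inner ℝ (x : Euc m) ξ : ℝ), by fun_prop⟩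
  map_add' ξ η := by
    ext x
    simp [inner_add_right, mul_add]
  map_smul' c ξ := by
    ext x
    simp [inner_smul_right]
    ring

theorem phase_apply (r : ℝ) (ξ : Euc m) (x : Metric.closedBall (0 : Euc m) r) :
    phase m r ξ x = -Complex.I * (inner ℝ (x : Euc m) ξ : ℝ) := rfl

instance (r : ℝ) : CompactSpace (Metric.closedBall (0 : Euc m) r) :=
  isCompact_iff_compactSpace.1 (isCompact_closedBall _ _)

theorem norm_exp_phase_le (r : ℝ) (ξ : Euc m) : ‖NormedSpace.exp (phase m r ξ)‖ ≤ 1 := by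
  refine (ContinuousMap.norm_le _ zero_le_one).2 fun x => ?_
  rw [ContinuousMap.exp_apply_complex, phase_apply, Complex.norm_exp]
  simp

theorem contDiff_exp_phase (r : ℝ) :
    ContDiff ℝ ∞ fun ξ : Euc m => NormedSpace.exp (phase m r ξ) := by
  have h : ContDiff ℝ ∞ (NormedSpace.exp : C(Metric.closedBall (0 : Euc m) r, ℂ) → _) :=
    AnalyticOnNhd.contDiff fun x _ => NormedSpace.exp_analytic (𝕂 := ℝ) x
  exact h.comp (LinearMap.toContinuousLinearMap (phase m r)).contDiff

/-- Derivatives of a Fourier transform are Fourier transforms of polynomial multiples. -/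
theorem exists_iteratedLineDerivOp_fourierSchwartz (n : ℕ) (v : Fin n → Euc m)
    (φ : 𝓢(Euc m, ℂ)) : ∃ ψ : 𝓢(Euc m, ℂ),
      (∀ ξ, ψ ξ = (∏ j, (-Complex.I * (inner ℝ ξ (v j) : ℝ))) * φ ξ) ∧
      ∂^{v} (fourierSchwartz m φ) = fourierSchwartz m ψ := by
  induction n generalizing φ with
  | zero => exact ⟨φ, by simp, by simp⟩
  | succ n ih =>
    have htg : (fun x : Euc m => (inner ℝ x (v (Fin.last n)) : ℝ)).HasTemperateGrowth := by
      fun_prop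
    let φ' : 𝓢(Euc m, ℂ) := -Complex.I •
      SchwartzMap.smulLeftCLM ℂ (fun x => (inner ℝ x (v (Fin.last n)) : ℝ)) φ
    have hφ' : ∀ ξ, φ' ξ = -Complex.I * (inner ℝ ξ (v (Fin.last n)) : ℝ) * φ ξ := by
      intro ξ
      change -Complex.I • (SchwartzMap.smulLeftCLM ℂ _ φ ξ) = _
      rw [SchwartzMap.smulLeftCLM_apply_apply htg]
      simp [mul_assoc]
    have h1 : ∂_{v (Fin.last n)} (fourierSchwartz m φ) = fourierSchwartz m φ' := by
      set c : ℂ := (((2 * Real.pi) ^ (-(m : ℝ) / 2) : ℝ) : ℂ)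
      change ∂_{v (Fin.last n)} (c • SchwartzMap.compCLMOfContinuousLinearEquiv ℂ (dilation m)
        (FourierTransform.fourier φ)) = c • SchwartzMap.compCLMOfContinuousLinearEquiv ℂ (dilation m)
        (FourierTransform.fourier φ')
      rw [LineDeriv.lineDerivOp_smul, SchwartzMap.lineDerivOp_compCLMOfContinuousLinearEquiv]
      have hd : dilation m (v (Fin.last n)) = ((2 * Real.pi)⁻¹ : ℝ) • v (Fin.last n) := rfl
      rw [hd, LineDeriv.lineDerivOp_left_smul, SchwartzMap.lineDerivOp_fourier_eq,
        ← FourierTransform.fourier_smul]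
      congr 3
      ext ξ
      change ((2 * Real.pi)⁻¹ : ℝ) • (-(2 * Real.pi * Complex.I)) •
          (SchwartzMap.smulLeftCLM ℂ (fun x => (inner ℝ x (v (Fin.last n)) : ℝ)) φ ξ) =
          -Complex.I • (SchwartzMap.smulLeftCLM ℂ (fun x => (inner ℝ x (v (Fin.last n)) : ℝ)) φ ξ)
      rw [← smul_assoc]
      congr 1
      rw [Complex.real_smul]
      push_cast
      field_simp
    obtain ⟨ψ, hψ, h2⟩ := ih (Fin.init v) φ'
    refine ⟨ψ, fun ξ => ?_, ?_⟩
    · rw [hψ, hφ', Fin.prod_univ_castSucc]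
      simp only [Fin.init]
      ring
    · rw [LineDeriv.iteratedLineDerivOp_succ_right, h1, h2]

/-- On a closed ball, the Fourier transform of a Schwartz function is the Bochner integral of
exponentials in the Banach space of continuous functions; functionals pass through the integral. -/
theorem clm_restrict_fourierSchwartz (r : ℝ) (L : C(Metric.closedBall (0 : Euc m) r, ℂ) →L[ℂ] ℂ)
    (ψ : 𝓢(Euc m, ℂ)) :
    L ((fourierSchwartz m ψ).toContinuousMap.restrict (Metric.closedBall 0 r)) =
      (((2 * Real.pi) ^ (-(m : ℝ) / 2) : ℝ) : ℂ) *
        ∫ ξ, L (NormedSpace.exp (phase m r ξ)) * ψ ξ := by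
  have hcont : Continuous fun ξ : Euc m => NormedSpace.exp (phase m r ξ) :=
    (contDiff_exp_phase r).continuous
  have hint : Integrable fun ξ : Euc m => ψ ξ • NormedSpace.exp (phase m r ξ) := by
    refine ψ.integrable.norm.mono' (ψ.continuous.smul hcont).aestronglyMeasurable
      (Filter.Eventually.of_forall fun ξ => ?_)
    rw [norm_smul]
    exact mul_le_of_le_one_right (norm_nonneg _) (norm_exp_phase_le r ξ)
  have hres : (fourierSchwartz m ψ).toContinuousMap.restrict (Metric.closedBall 0 r) =
      (((2 * Real.pi) ^ (-(m : ℝ) / 2) : ℝ) : ℂ) •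
        ∫ ξ, ψ ξ • NormedSpace.exp (phase m r ξ) := by
    ext x
    have hev := (ContinuousMap.evalCLM ℂ x).integral_comp_comm hint
    change fourierSchwartz m ψ x = _ * (ContinuousMap.evalCLM ℂ x) _
    rw [← hev, fourierSchwartz_apply]
    congr 2
    funext ξ
    change _ = ψ ξ * NormedSpace.exp (phase m r ξ) x
    rw [ContinuousMap.exp_apply_complex, phase_apply, mul_comm, real_inner_comm]
  rw [hres, map_smul, ← L.integral_comp_comm hint, smul_eq_mul]
  congr 2
  funext ξ
  rw [map_smul, smul_eq_mul, mul_comm]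

/-- The Fourier transform of a compactly supported distribution is a smooth function, whose
restriction to every real line extends to an entire function of exponential type. -/
theorem exists_fourierDist_eq_integral (u : CompactDist m) :
    ∃ g : Euc m → ℂ, ContDiff ℝ ∞ g ∧
      (∀ φ : 𝓢(Euc m, ℂ), fourierDist m u.1 φ = ∫ x, g x * φ x) ∧
      ∀ ξ θ : Euc m, ∃ f : ℂ → ℂ, IsExpType f ∧ ∀ t : ℝ, f t = g (ξ + t • θ) := by
  obtain ⟨r, ι, _, n, v, L, hL⟩ := TemperedDistribution.exists_representation u.2
  set c : ℂ := (((2 * Real.pi) ^ (-(m : ℝ) / 2) : ℝ) : ℂ) with hc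
  refine ⟨fun ξ => c * ∑ i, L i (NormedSpace.exp (phase m r ξ)) *
    ∏ j, (-Complex.I * (inner ℝ ξ (v i j) : ℝ)), ?_, fun φ => ?_, fun ξ θ => ?_⟩
  · refine contDiff_const.mul (ContDiff.sum fun i _ => ?_)
    refine ((L i).restrictScalars ℝ).contDiff.comp (contDiff_exp_phase r) |>.mul ?_
    refine contDiff_prod fun j _ => contDiff_const.mul ?_
    exact Complex.ofRealCLM.contDiff.comp (contDiff_id.inner ℝ contDiff_const)
  · change u.1 (fourierSchwartz m φ) = _
    rw [hL]
    choose ψ hψ hψF using fun i => exists_iteratedLineDerivOp_fourierSchwartz (n i) (v i) φ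
    have hint : ∀ i, Integrable fun ξ => L i (NormedSpace.exp (phase m r ξ)) * ψ i ξ := by
      intro i
      refine ((ψ i).integrable.norm.const_mul ‖L i‖).mono'
        (((L i).continuous.comp (contDiff_exp_phase r).continuous).mul
          (ψ i).continuous).aestronglyMeasurable (Filter.Eventually.of_forall fun ξ => ?_)
      rw [norm_mul]
      gcongr
      exact ((L i).le_opNorm_of_le (norm_exp_phase_le r ξ)).trans (mul_one _).le
    simp_rw [hψF, clm_restrict_fourierSchwartz]
    rw [← Finset.mul_sum, ← integral_finsetSum _ fun i _ => hint i, ← integral_const_mul]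
    congr 1
    funext ξ
    rw [mul_assoc, Finset.sum_mul]
    congr 1
    refine Finset.sum_congr rfl fun i _ => ?_
    rw [hψ, mul_assoc]
  · refine ⟨fun z => c * ∑ i, L i (NormedSpace.exp (phase m r ξ + z • phase m r θ)) *
      ∏ j, (-Complex.I * ((inner ℝ ξ (v i j) : ℝ) + z * (inner ℝ θ (v i j) : ℝ))), ?_, fun t => ?_⟩
    · refine (IsExpType.const c).mul (IsExpType.sum _ fun i _ =>
        (IsExpType.clm_exp (L i) _ _).mul (IsExpType.prod _ fun j _ => ?_))
      exact (IsExpType.const _).mul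
        ((IsExpType.const _).add (IsExpType.id.mul (IsExpType.const _)))
    · have h1 : phase m r (ξ + t • θ) = phase m r ξ + (t : ℂ) • phase m r θ := by
        rw [map_add, map_smul]
        rfl
      simp only [h1, inner_add_left, inner_smul_left]
      simp

theorem fourierSchwartz_surjective : Function.Surjective (fourierSchwartz m) := by
  intro φ
  have hc : (((2 * Real.pi) ^ (-(m : ℝ) / 2) : ℝ) : ℂ) ≠ 0 := by
    exact_mod_cast (Real.rpow_pos_of_pos Real.two_pi_pos _).ne'
  refine ⟨FourierTransform.fourierInv (E := 𝓢(Euc m, ℂ)) (((((2 * Real.pi) ^ (-(m : ℝ) / 2) : ℝ) : ℂ))⁻¹ •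
    SchwartzMap.compCLMOfContinuousLinearEquiv ℂ (dilation m).symm φ), ?_⟩
  change (((2 * Real.pi) ^ (-(m : ℝ) / 2) : ℝ) : ℂ) •
    SchwartzMap.compCLMOfContinuousLinearEquiv ℂ (dilation m)
      (FourierTransform.fourier (FourierTransform.fourierInv (E := 𝓢(Euc m, ℂ)) _)) = φ
  rw [FourierTransform.fourier_fourierInv_eq, map_smul, smul_smul, mul_inv_cancel₀ hc, one_smul]
  ext x
  simp

theorem fourierDist_injective : Function.Injective (fourierDist m) := by
  intro u v h
  ext φ
  obtain ⟨ψ, rfl⟩ := fourierSchwartz_surjective φ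
  exact DFunLike.congr_fun h ψ

/-- A smooth function is determined by the distribution that it defines. -/
theorem IsSmoothFunction.unique {T : 𝓢'(Euc m, ℂ)} {f g : Euc m → ℂ} (hf : IsSmoothFunction T f)
    (hg : IsSmoothFunction T g) : f = g := by
  refine (Continuous.ae_eq_iff_eq volume hf.1.continuous hg.1.continuous).1 ?_
  refine ae_eq_of_integral_contDiff_smul_eq hf.1.continuous.locallyIntegrable
    hg.1.continuous.locallyIntegrable fun φ hφ hc => ?_
  have hc' : HasCompactSupport fun x => (φ x : ℂ) := hc.comp_left (g := Complex.ofReal) rfl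
  let ψ : 𝓢(Euc m, ℂ) := hc'.toSchwartzMap (Complex.ofRealCLM.contDiff.comp hφ)
  have h := (hf.2 ψ hc').symm.trans (hg.2 ψ hc')
  have hψ : ∀ x, ψ x = φ x := fun x => rfl
  simpa only [hψ, Complex.real_smul, mul_comm] using h

theorem isSmoothFunction_toFunction {T : 𝓢'(Euc m, ℂ)} (h : ∃ g, IsSmoothFunction T g) :
    IsSmoothFunction T (toFunction T) := by
  rw [toFunction, dif_pos h]
  exact h.choose_spec

/-- The Fourier transform of a compactly supported distribution, as a function. -/
noncomputable def fourierFun (u : CompactDist m) : Euc m → ℂ := toFunction (fourierDist m u.1)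

theorem isSmoothFunction_fourierFun (u : CompactDist m) :
    IsSmoothFunction (fourierDist m u.1) (fourierFun u) := by
  obtain ⟨g, hg, hgi, -⟩ := exists_fourierDist_eq_integral u
  exact isSmoothFunction_toFunction ⟨g, hg, fun φ _ => hgi φ⟩

theorem fourierDist_apply (u : CompactDist m) (φ : 𝓢(Euc m, ℂ)) :
    fourierDist m u.1 φ = ∫ x, fourierFun u x * φ x := by
  obtain ⟨g, hg, hgi, -⟩ := exists_fourierDist_eq_integral u
  rw [(isSmoothFunction_fourierFun u).unique ⟨hg, fun φ _ => hgi φ⟩]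
  exact hgi φ

theorem exists_isExpType_fourierFun (u : CompactDist m) (ξ θ : Euc m) :
    ∃ f : ℂ → ℂ, IsExpType f ∧ ∀ t : ℝ, f t = fourierFun u (ξ + t • θ) := by
  obtain ⟨g, hg, hgi, h⟩ := exists_fourierDist_eq_integral u
  rw [(isSmoothFunction_fourierFun u).unique ⟨hg, fun φ _ => hgi φ⟩]
  exact h ξ θ

theorem fourierFun_injective : Function.Injective (fourierFun (m := m)) := by
  intro u v h
  refine Subtype.ext (fourierDist_injective ?_)
  ext φ
  rw [fourierDist_apply, fourierDist_apply, h]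

end PhaseRetrieval

/-! ### Products with smooth functions -/

namespace PhaseRetrieval

variable {m : ℕ} {w : Euc m → ℂ}

theorem exists_schwartz_eq_mul (hw : ContDiff ℝ ∞ w) {φ : 𝓢(Euc m, ℂ)}
    (hφ : HasCompactSupport φ) :
    ∃ ψ : 𝓢(Euc m, ℂ), HasCompactSupport ψ ∧ ∀ x, ψ x = w x * φ x :=
  have hc : HasCompactSupport fun x => w x * φ x := hφ.mul_left
  ⟨hc.toSchwartzMap (hw.mul (φ.smooth ⊤)), hc, fun _ => rfl⟩

/-- Tempered distributions are determined by their values on compactly supported functions. -/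
theorem ext_of_hasCompactSupport {u v : 𝓢'(Euc m, ℂ)}
    (h : ∀ φ : 𝓢(Euc m, ℂ), HasCompactSupport φ → u φ = v φ) : u = v := by
  ext φ
  obtain ⟨χ, hχ, hc, h1⟩ := exists_smooth_cutoff (E := Euc m) 1
  have hlim := SchwartzMap.tendsto_smulLeftCLM_dilate hχ hc h1 φ
  refine tendsto_nhds_unique (((map_continuous u).tendsto φ).comp hlim)
    ((((map_continuous v).tendsto φ).comp hlim).congr fun k => (h _ ?_).symm)
  have hck : HasCompactSupport fun x => χ (((k : ℝ) + 1)⁻¹ • x) := hc.comp_smul (by positivity)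
  exact hck.of_isClosed_subset (isClosed_tsupport _)
    ((SchwartzMap.tsupport_smulLeftCLM_subset _ φ).trans Set.inter_subset_right)

theorem IsProduct.right_unique (hw : ContDiff ℝ ∞ w) {h v v' : 𝓢'(Euc m, ℂ)}
    (hv : IsProduct w h v) (hv' : IsProduct w h v') : v = v' := by
  refine ext_of_hasCompactSupport fun φ hφ => ?_
  obtain ⟨ψ, -, hψ⟩ := exists_schwartz_eq_mul hw hφ
  rw [hv φ ψ hφ hψ, hv' φ ψ hφ hψ]

/-- Division by a nowhere vanishing `w` shows that `h` can be recovered from `w · h`. -/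
theorem IsProduct.left_unique (hw : ContDiff ℝ ∞ w) (hw0 : ∀ x, w x ≠ 0)
    {h h' v : 𝓢'(Euc m, ℂ)} (hv : IsProduct w h v) (hv' : IsProduct w h' v) : h = h' := by
  refine ext_of_hasCompactSupport fun φ hφ => ?_
  obtain ⟨ψ, hψc, hψ⟩ := exists_schwartz_eq_mul (hw.inv hw0) hφ
  have hφψ : ∀ x, φ x = w x * ψ x := fun x => by
    rw [hψ]
    exact (mul_inv_cancel_left₀ (hw0 x) _).symm
  rw [← hv ψ φ hψc hφψ, hv' ψ φ hψc hφψ]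

theorem exists_isProduct (hw : ContDiff ℝ ∞ w) (h : CompactDist m) :
    ∃ v : CompactDist m, IsProduct w h.1 v.1 := by
  obtain ⟨R, hR⟩ := TemperedDistribution.exists_dsupport_subset_ball h.2
  obtain ⟨χ, hχ, hc, h1⟩ := exists_smooth_cutoff (E := Euc m) R
  have hcw : HasCompactSupport fun x => χ x * w x := hc.mul_right
  have htg := hcw.hasTemperateGrowth (hχ.mul hw)
  refine ⟨⟨TemperedDistribution.smulLeftCLM ℂ (fun x => χ x * w x) h.1,
    h.2.of_isClosed_subset isClosed_dsupport
      (TemperedDistribution.dsupport_smulLeftCLM_subset htg)⟩, fun φ ψ _ hψ => ?_⟩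
  refine TemperedDistribution.apply_eq_of_eqOn_ball hR fun x hx => ?_
  change SchwartzMap.smulLeftCLM ℂ (fun x => χ x * w x) φ x = ψ x
  rw [SchwartzMap.smulLeftCLM_apply_apply htg, h1 x hx, one_mul, hψ, smul_eq_mul]

theorem existsUnique_isProduct (hw : ContDiff ℝ ∞ w) (h : CompactDist m) :
    ∃! v : CompactDist m, IsProduct w h.1 v.1 :=
  existsUnique_of_exists_of_unique (exists_isProduct hw h)
    fun _ _ hv hv' => Subtype.ext (hv.right_unique hw hv')

theorem exists_smoothMul_eq (hw : ContDiff ℝ ∞ w) (h : CompactDist m) :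
    ∃ v : CompactDist m, smoothMul w h = v.1 ∧ IsProduct w h.1 v.1 := by
  have H := exists_isProduct hw h
  exact ⟨H.choose, dif_pos H, H.choose_spec⟩

/-! ### Uniqueness in phase retrieval -/

open ComplexConjugate in
/-- The product of the transform of `p` and the conjugate of `V - V'` vanishes on every line
through the open set where the data agree. The data, restricted to such a line, extend to a
combination of `exp (β z²)`, `exp (conj β z²)` and `1` over the functions of exponential type,
whose first coefficient must agree for both unknowns. The parameter `ε` covers the full (`ε = 0`)
and the linearized (`ε = 1`) data. -/
theorem fourierFun_mul_conj_sub_eq_zero_on_line {α : ℂ} (hα : α.im ≠ 0) (p v v' : CompactDist m)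
    (ε : ℝ) {U : Set (Euc m)} (hU : IsOpen U)
    (h : ∀ ξ ∈ U,
      ‖fourierFun p ξ * Complex.exp (α * ((‖ξ‖ ^ 2 : ℝ) : ℂ)) + fourierFun v ξ‖ ^ 2
          - ε * ‖fourierFun v ξ‖ ^ 2 =
        ‖fourierFun p ξ * Complex.exp (α * ((‖ξ‖ ^ 2 : ℝ) : ℂ)) + fourierFun v' ξ‖ ^ 2
          - ε * ‖fourierFun v' ξ‖ ^ 2)
    {ξ₀ θ : Euc m} (hξ₀ : ξ₀ ∈ U) (hθ : θ ≠ 0) (t : ℝ) :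
    fourierFun p (ξ₀ + t • θ) *
      conj (fourierFun v (ξ₀ + t • θ) - fourierFun v' (ξ₀ + t • θ)) = 0 := by
  obtain ⟨fp, hfp, hp⟩ := exists_isExpType_fourierFun p ξ₀ θ
  obtain ⟨f, hf, hv⟩ := exists_isExpType_fourierFun v ξ₀ θ
  obtain ⟨f', hf', hv'⟩ := exists_isExpType_fourierFun v' ξ₀ θ
  -- Complete `α ‖ξ₀ + t θ‖²` to `β t²` plus an affine function of `t`.
  set β : ℂ := α * ((‖θ‖ ^ 2 : ℝ) : ℂ) with hβ
  have hβim : β.im ≠ 0 := by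
    rw [hβ, Complex.im_mul_ofReal]
    exact mul_ne_zero hα (by positivity)
  obtain ⟨q, hq⟩ : ∃ q : ℂ → ℂ, q = fun z => fp z * (Complex.exp (α * ((‖ξ₀‖ ^ 2 : ℝ) : ℂ)) *
    Complex.exp (2 * α * ((inner ℝ ξ₀ θ : ℝ) : ℂ) * z)) := ⟨_, rfl⟩
  have hqe : IsExpType q := hq ▸ hfp.mul ((IsExpType.const _).mul (IsExpType.exp_mul _))
  have hqt : ∀ t : ℝ, fourierFun p (ξ₀ + t • θ) *
      Complex.exp (α * ((‖ξ₀ + t • θ‖ ^ 2 : ℝ) : ℂ)) = q t * Complex.exp (β * (t : ℂ) ^ 2) := by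
    intro t
    rw [hq, ← hp]
    simp only
    rw [mul_assoc, ← Complex.exp_add, ← Complex.exp_add]
    congr 2
    rw [norm_add_sq_real, inner_smul_right, norm_smul, mul_pow, Real.norm_eq_abs, sq_abs, hβ]
    push_cast
    ring
  have hA : IsExpType fun z => q z * (conj (f (conj z)) - conj (f' (conj z))) :=
    hqe.mul (hf.conj_conj.sub hf'.conj_conj)
  have hB : IsExpType fun z => conj (q (conj z)) * (f z - f' z) := hqe.conj_conj.mul (hf.sub hf')
  have hC : IsExpType fun z => (1 - (ε : ℂ)) * (f z * conj (f (conj z)) - f' z * conj (f' (conj z))) :=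
    (IsExpType.const _).mul ((hf.mul hf.conj_conj).sub (hf'.mul hf'.conj_conj))
  have hzero : (fun z => q z * (conj (f (conj z)) - conj (f' (conj z))) * Complex.exp (β * z ^ 2) +
      conj (q (conj z)) * (f z - f' z) * Complex.exp (conj β * z ^ 2) +
      (1 - (ε : ℂ)) * (f z * conj (f (conj z)) - f' z * conj (f' (conj z)))) = fun _ => 0 := by
    refine Differentiable.eq_of_eventually_eq_ofReal ?_ (differentiable_const 0) ?_
    · exact ((hA.1.mul (by fun_prop)).add (hB.1.mul (by fun_prop))).add hC.1
    · have hmem : ∀ᶠ t : ℝ in nhds 0, ξ₀ + t • θ ∈ U :=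
        (by fun_prop : Continuous fun t : ℝ => ξ₀ + t • θ).continuousAt.eventually_mem
          (hU.mem_nhds (by simpa using hξ₀))
      filter_upwards [hmem] with t ht
      have hdata := h _ ht
      rw [hqt] at hdata
      have key := congrArg (fun r : ℝ => (r : ℂ)) hdata
      simp only [← hv, ← hv', Complex.ofReal_sub, Complex.ofReal_mul, Complex.ofReal_pow,
        ← Complex.mul_conj', map_add, map_mul, ← Complex.exp_conj, map_pow,
        Complex.conj_ofReal] at key
      simp only [Complex.conj_ofReal]
      linear_combination key
  have hfin := hA.eq_zero_of_gaussian_combination hB hC hβim (congrFun hzero) t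
  simp only [Complex.conj_ofReal, hv, hv', hq, hp] at hfin
  rw [map_sub]
  have hne : Complex.exp (α * ((‖ξ₀‖ ^ 2 : ℝ) : ℂ)) *
      Complex.exp (2 * α * ((inner ℝ ξ₀ θ : ℝ) : ℂ) * t) ≠ 0 :=
    mul_ne_zero (Complex.exp_ne_zero _) (Complex.exp_ne_zero _)
  rw [mul_right_comm] at hfin
  exact (mul_eq_zero.1 hfin).resolve_right hne

theorem eq_of_data_eqOn (hm : 1 ≤ m) {α : ℂ} (hα : α.im ≠ 0) {p v v' : CompactDist m}
    (hp : p.1 ≠ 0) (ε : ℝ) {U : Set (Euc m)} (hU : IsOpen U) (hne : U.Nonempty)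
    (h : ∀ ξ ∈ U,
      ‖fourierFun p ξ * Complex.exp (α * ((‖ξ‖ ^ 2 : ℝ) : ℂ)) + fourierFun v ξ‖ ^ 2
          - ε * ‖fourierFun v ξ‖ ^ 2 =
        ‖fourierFun p ξ * Complex.exp (α * ((‖ξ‖ ^ 2 : ℝ) : ℂ)) + fourierFun v' ξ‖ ^ 2
          - ε * ‖fourierFun v' ξ‖ ^ 2) : v = v' := by
  obtain ⟨ξ₀, hξ₀⟩ := hne
  have : Nonempty (Fin m) := Fin.pos_iff_nonempty.1 hm
  have hprod : ∀ ξ, fourierFun p ξ * starRingEnd ℂ (fourierFun v ξ - fourierFun v' ξ) = 0 := by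
    intro ξ
    rcases eq_or_ne ξ ξ₀ with rfl | hξ
    · obtain ⟨θ, hθ⟩ := exists_ne (0 : Euc m)
      simpa using fourierFun_mul_conj_sub_eq_zero_on_line hα p v v' ε hU h hξ₀ hθ 0
    · simpa using fourierFun_mul_conj_sub_eq_zero_on_line hα p v v' ε hU h hξ₀ (sub_ne_zero.2 hξ) 1
  obtain ⟨ξ₁, hξ₁⟩ : ∃ ξ₁, fourierFun p ξ₁ ≠ 0 := by
    by_contra! hz
    refine hp (fourierDist_injective ?_)
    ext φ
    rw [fourierDist_apply, map_zero]
    simp [hz]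
  -- Along a line through `ξ₁` the transform of `p` does not vanish near `ξ₁`.
  refine fourierFun_injective (funext fun ξ => ?_)
  obtain ⟨f, hf, hv⟩ := exists_isExpType_fourierFun v ξ₁ (ξ - ξ₁)
  obtain ⟨f', hf', hv'⟩ := exists_isExpType_fourierFun v' ξ₁ (ξ - ξ₁)
  have hcont : Continuous fun t : ℝ => fourierFun p (ξ₁ + t • (ξ - ξ₁)) :=
    (isSmoothFunction_fourierFun p).1.continuous.comp (by fun_prop)
  have hff' : f = f' := by
    refine hf.1.eq_of_eventually_eq_ofReal hf'.1 ?_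
    have h0 : fourierFun p (ξ₁ + (0 : ℝ) • (ξ - ξ₁)) ≠ 0 := by simpa using hξ₁
    filter_upwards [hcont.continuousAt.eventually_ne h0] with t ht
    rw [hv, hv', ← sub_eq_zero]
    exact (map_eq_zero (starRingEnd ℂ)).1
      ((mul_eq_zero.1 (hprod (ξ₁ + t • (ξ - ξ₁)))).resolve_left ht)
  have h1 := hv 1
  rw [hff', hv'] at h1
  simpa using h1.symm

theorem forward_eq {α : ℂ} {p h v : CompactDist m} (hv : smoothMul w h = v.1) :
    forward w α p h = fun ξ => ‖fourierFun p ξ * Complex.exp (α * ((‖ξ‖ ^ 2 : ℝ) : ℂ)) +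
      fourierFun v ξ‖ ^ 2 := by
  funext ξ
  rw [forward, hv]
  rfl

theorem forwardLin_eq {α : ℂ} {p h v : CompactDist m} (hv : smoothMul w h = v.1) :
    forwardLin w α p h = fun ξ => ‖fourierFun p ξ * Complex.exp (α * ((‖ξ‖ ^ 2 : ℝ) : ℂ)) +
      fourierFun v ξ‖ ^ 2 - ‖fourierFun v ξ‖ ^ 2 := by
  funext ξ
  rw [forwardLin, hv]
  rfl

theorem contDiff_forward (hw : ContDiff ℝ ∞ w) (α : ℂ) (p h : CompactDist m) :
    ContDiff ℝ ∞ (forward w α p h) := by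
  obtain ⟨v, hv, -⟩ := exists_smoothMul_eq hw h
  rw [forward_eq hv]
  have h1 : ContDiff ℝ ∞ fun ξ : Euc m => Complex.exp (α * ((‖ξ‖ ^ 2 : ℝ) : ℂ)) :=
    (contDiff_const.mul (Complex.ofRealCLM.contDiff.comp (contDiff_norm_sq ℝ))).cexp
  exact (((isSmoothFunction_fourierFun p).1.mul h1).add
    (isSmoothFunction_fourierFun v).1).norm_sq ℝ

theorem contDiff_forwardLin (hw : ContDiff ℝ ∞ w) (α : ℂ) (p h : CompactDist m) :
    ContDiff ℝ ∞ (forwardLin w α p h) := by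
  obtain ⟨v, hv, -⟩ := exists_smoothMul_eq hw h
  have := (contDiff_forward hw α p h).sub ((isSmoothFunction_fourierFun v).1.norm_sq ℝ)
  rw [forward_eq hv] at this
  rwa [forwardLin_eq hv]

theorem eq_of_forward_eqOn (hm : 1 ≤ m) (hw : ContDiff ℝ ∞ w) (hw0 : ∀ x, w x ≠ 0) {α : ℂ}
    (hα : α.im ≠ 0) {p h h' : CompactDist m} (hp : p.1 ≠ 0) {U : Set (Euc m)} (hU : IsOpen U)
    (hne : U.Nonempty) (heq : Set.EqOn (forward w α p h) (forward w α p h') U) : h = h' := by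
  obtain ⟨v, hv, hP⟩ := exists_smoothMul_eq hw h
  obtain ⟨v', hv', hP'⟩ := exists_smoothMul_eq hw h'
  rw [forward_eq hv, forward_eq hv'] at heq
  obtain rfl : v = v' := eq_of_data_eqOn hm hα hp 0 hU hne fun ξ hξ => by simpa using heq hξ
  exact Subtype.ext (hP.left_unique hw hw0 hP')

theorem eq_of_forwardLin_eqOn (hm : 1 ≤ m) (hw : ContDiff ℝ ∞ w) (hw0 : ∀ x, w x ≠ 0) {α : ℂ}
    (hα : α.im ≠ 0) {p h h' : CompactDist m} (hp : p.1 ≠ 0) {U : Set (Euc m)} (hU : IsOpen U)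
    (hne : U.Nonempty) (heq : Set.EqOn (forwardLin w α p h) (forwardLin w α p h') U) : h = h' := by
  obtain ⟨v, hv, hP⟩ := exists_smoothMul_eq hw h
  obtain ⟨v', hv', hP'⟩ := exists_smoothMul_eq hw h'
  rw [forwardLin_eq hv, forwardLin_eq hv'] at heq
  obtain rfl : v = v' := eq_of_data_eqOn hm hα hp 1 hU hne fun ξ hξ => by simpa using heq hξ
  exact Subtype.ext (hP.left_unique hw hw0 hP')

end PhaseRetrieval

theorem theorem1 (m : ℕ) (hm : 1 ≤ m)
    (w : PhaseRetrieval.Euc m → ℂ) (hw : ContDiff ℝ ∞ w) (hw0 : ∀ x, w x ≠ 0)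
    (α : ℂ) (hα : α ∉ Set.range (fun r : ℝ => (r : ℂ)))
    (p : PhaseRetrieval.CompactDist m) (hp : p.1 ≠ 0) :
    -- `F` and `F_lin` are well defined: products `w · h` exist uniquely, Fourier transforms of
    -- compactly supported distributions are unique smooth functions, the values are smooth.
    (∀ h : PhaseRetrieval.CompactDist m,
      ∃! v : PhaseRetrieval.CompactDist m, PhaseRetrieval.IsProduct w h.1 v.1) ∧
    (∀ u : PhaseRetrieval.CompactDist m,
      ∃! g : PhaseRetrieval.Euc m → ℂ,
        PhaseRetrieval.IsSmoothFunction (PhaseRetrieval.fourierDist m u.1) g) ∧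
    (∀ h : PhaseRetrieval.CompactDist m,
      ContDiff ℝ ∞ (PhaseRetrieval.forward w α p h) ∧
      ContDiff ℝ ∞ (PhaseRetrieval.forwardLin w α p h)) ∧
    -- Injectivity.
    Function.Injective (PhaseRetrieval.forward w α p) ∧
    Function.Injective (PhaseRetrieval.forwardLin w α p) ∧
    -- Uniqueness from data on an arbitrary nonempty open set.
    (∀ U : Set (PhaseRetrieval.Euc m), IsOpen U → U.Nonempty →
      Function.Injective (fun h : PhaseRetrieval.CompactDist m =>
        U.domRestrict (PhaseRetrieval.forward w α p h)) ∧
      Function.Injective (fun h : PhaseRetrieval.CompactDist m =>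
        U.domRestrict (PhaseRetrieval.forwardLin w α p h))) := by
  have hα' : α.im ≠ 0 := fun h => hα ⟨α.re, Complex.ext rfl h.symm⟩
  have hF : ∀ U : Set (PhaseRetrieval.Euc m), IsOpen U → U.Nonempty →
      Function.Injective (fun h : PhaseRetrieval.CompactDist m =>
        U.domRestrict (PhaseRetrieval.forward w α p h)) := fun U hU hne h h' heq =>
    PhaseRetrieval.eq_of_forward_eqOn hm hw hw0 hα' hp hU hne fun ξ hξ => congrFun heq ⟨ξ, hξ⟩
  have hL : ∀ U : Set (PhaseRetrieval.Euc m), IsOpen U → U.Nonempty →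
      Function.Injective (fun h : PhaseRetrieval.CompactDist m =>
        U.domRestrict (PhaseRetrieval.forwardLin w α p h)) := fun U hU hne h h' heq =>
    PhaseRetrieval.eq_of_forwardLin_eqOn hm hw hw0 hα' hp hU hne fun ξ hξ => congrFun heq ⟨ξ, hξ⟩
  refine ⟨PhaseRetrieval.existsUnique_isProduct hw, fun u => ?_, fun h =>
    ⟨PhaseRetrieval.contDiff_forward hw α p h, PhaseRetrieval.contDiff_forwardLin hw α p h⟩,
    fun h h' heq => ?_, fun h h' heq => ?_, fun U hU hne => ⟨hF U hU hne, hL U hU hne⟩⟩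
  · exact ⟨_, PhaseRetrieval.isSmoothFunction_fourierFun u,
      fun g hg => hg.unique (PhaseRetrieval.isSmoothFunction_fourierFun u)⟩
  · exact hF Set.univ isOpen_univ Set.univ_nonempty (congrArg (Set.univ).domRestrict heq)
  · exact hL Set.univ isOpen_univ Set.univ_nonempty (congrArg (Set.univ).domRestrict heq)
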